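/- Let $M\ge 2$ be an integer, $S=\{0,1,\dots,M\}$, and let $P\colon S\times S\to[0,1]$ satisfy $P(a,0)=1$ and $P(0,b)=0$ for all $a,b\in S\setminus\{0\}$ (the value $P(0,0)$ is irrelevant). Two players play the following game with total capital $M$. Let $X_n$ and $Y_n=M-X_n$ be the fortunes of players I and II at stage $n$. Given the history of fortunes up to stage $n$, the players choose, independently of each other and possibly at random, bets $a_n\in\{0,\dots,X_n\}$ and $b_n\in\{0,\dots,Y_n\}$, a bet having to be positive whenever the player's fortune is positive; then $X_{n+1}=X_n+b_n$ with probability $P(a_n,b_n)$ and $X_{n+1}=X_n-a_n$ with probability $1-P(a_n,b_n)$. (The states $0$ and $M$ of $X_n$ are therefore absorbing.) A strategy of a player is a rule assigning to each history of fortunes a (possibly random) legal bet. The bold strategy always bets the entire current fortune; the timid strategy always bets one unit when the current fortune is positive. Suppose that $\varphi\colon S\to[0,1]$, $\varphi(x)=P(x,1)$, is nondecreasing and satisfies $$\varphi(y)-\varphi(x)\le \varphi(x-y)\,[\varphi(y)-1]\qquad\text{for all } x,y\in S \text{ with } y\le x .$$ If player II plays timidly, then the bold strategy is optimal for player I: for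 every initial fortune $x_0\in S$ of player I and every strategy $\sigma$ of player I, the probability $\mathbb P(X_n=M\text{ for some }n)$ that player I wins under $\sigma$ is at most the corresponding probability under bold play, and likewise the expected ultimate fortune $\mathbb E[\limsup_n X_n]$ of player I under $\sigma$ is at most the one under bold play. -/

import Mathlib

open MeasureTheory ProbabilityTheory Filter
open scoped ENNReal

noncomputable section

namespace RedBlack

/-- The set `S = {0, 1, …, M}` of possible fortunes; bets are taken from the same set. -/
abbrev State (M : ℕ) : Type := Fin (M + 1)

/-- Histories of fortunes up to (and including) stage `n`, stages being numbered from `0`. -/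
abbrev History (M n : ℕ) : Type := (i : Finset.Iic n) → State M

/-- The current (most recent) fortune of a history. -/
def History.current {M n : ℕ} (h : History M n) : State M := h ⟨n, Finset.mem_Iic.2 le_rfl⟩

/-- The opponent's history: when one player has `x`, the opponent has `M - x` (`Fin.rev x`). -/
def History.opponent {M n : ℕ} (h : History M n) : History M n := fun i => (h i).rev

/-- A strategy of a player: at every stage, given the history of the player's own fortunes
(equivalently, of both players' fortunes), it prescribes a possibly randomized bet.
A bet may not exceed the current fortune, and it has to be positive when the fortune is. -/
structure Strategy (M : ℕ) where
  bet : (n : ℕ) → History M n → PMF (State M)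
  legal : ∀ (n : ℕ) (h : History M n), ∀ a ∈ (bet n h).support,
    a ≤ h.current ∧ (0 < h.current → 0 < a)

/-- Bold play: bet the entire current fortune. -/
def bold (M : ℕ) : Strategy M where
  bet _ h := PMF.pure h.current
  legal n h a ha := by
    rw [PMF.support_pure, Set.mem_singleton_iff] at ha
    subst ha
    exact ⟨le_rfl, id⟩

/-- Timid play: bet one unit whenever the current fortune is positive. -/
def timid (M : ℕ) : Strategy M where
  bet _ h := PMF.pure (if h.current = 0 then 0 else 1)
  legal n h a ha := by
    rw [PMF.support_pure, Set.mem_singleton_iff] at ha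
    subst ha
    split_ifs with h0
    · simp [h0]
    · have hv : (h.current : ℕ) ≠ 0 := fun hv => h0 (Fin.ext hv)
      have hlt := h.current.isLt
      have h1 : ((1 : Fin (M + 1)) : ℕ) = 1 := by
        rw [Fin.val_one']
        exact Nat.mod_eq_of_lt (by omega)
      refine ⟨?_, fun _ => ?_⟩
      · rw [Fin.le_def, h1]; omega
      · rw [Fin.lt_def, h1]; simp

/-- Player I's fortune `x + b` after winning a stage in which player II bets `b`.
For a legal bet one has `b ≤ M - x`, so the truncation at `M` is never active. -/
def up {M : ℕ} (x b : State M) : State M := ⟨min (x + b : ℕ) M, by omega⟩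

/-- Player I's fortune `x - a` after losing a stage in which he bets `a` (legally `a ≤ x`). -/
def down {M : ℕ} (x a : State M) : State M := ⟨(x : ℕ) - (a : ℕ), by omega⟩

/-- The law of player I's next fortune, given his current fortune `x` and the bets `a`, `b` of
players I and II: `x + b` with probability `P a b` and `x - a` with probability `1 - P a b`. -/
def move {M : ℕ} (P : State M → State M → unitInterval) (x a b : State M) : Measure (State M) :=
  bernoulliMeasure (up x b) (down x a) (P a b)

/-- The law of player I's next fortune given the history `h` of his fortunes, when the players use
the strategies `σ` and `τ`; the two bets are drawn independently. -/
def nextLaw {M : ℕ} (P : State M → State M → unitInterval) (σ τ : Strategy M)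
    (n : ℕ) (h : History M n) : Measure (State M) :=
  ∑ a, ∑ b, (σ.bet n h a * τ.bet n h.opponent b) • move P h.current a b

instance {M : ℕ} (P : State M → State M → unitInterval) (σ τ : Strategy M)
    (n : ℕ) (h : History M n) : IsProbabilityMeasure (nextLaw P σ τ n h) := by
  constructor
  have hs : ∀ p : PMF (State M), ∑ a, p a = 1 := fun p => by
    rw [← tsum_fintype (L := .unconditional _)]; exact p.tsum_coe
  simp [nextLaw, move, ← Finset.mul_sum, hs]

/-- The transition kernel from histories up to stage `n` to the fortune at stage `n + 1`. -/
def stepKernel {M : ℕ} (P : State M → State M → unitInterval) (σ τ : Strategy M) (n : ℕ) :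
    Kernel (History M n) (State M) where
  toFun := nextLaw P σ τ n
  measurable' := measurable_of_countable _

instance {M : ℕ} (P : State M → State M → unitInterval) (σ τ : Strategy M) (n : ℕ) :
    IsMarkovKernel (stepKernel P σ τ n) :=
  ⟨fun h => inferInstanceAs (IsProbabilityMeasure (nextLaw P σ τ n h))⟩

/-- The law of the whole sequence of player I's fortunes, for the initial fortune `x₀`, when
player I uses `σ` and player II uses `τ`. -/
def gameLaw {M : ℕ} (P : State M → State M → unitInterval) (σ τ : Strategy M) (x₀ : State M) :
    Measure (ℕ → State M) :=
  Kernel.traj (X := fun _ => State M) (stepKernel P σ τ) 0 (fun _ => x₀)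

/-- The probability that player I ever reaches the goal `M`. -/
def winProb {M : ℕ} (P : State M → State M → unitInterval) (σ τ : Strategy M) (x₀ : State M) :
    ℝ≥0∞ :=
  gameLaw P σ τ x₀ {X | ∃ n, X n = Fin.last M}

/-- Player I's expected ultimate fortune, i.e. his expected utility for the identity utility
function. The upper limit is the final fortune on every path on which the game ends. -/
def expectedFortune {M : ℕ} (P : State M → State M → unitInterval) (σ τ : Strategy M)
    (x₀ : State M) : ℝ≥0∞ :=
  ∫⁻ X, limsup (fun n => ((X n : ℕ) : ℝ≥0∞)) atTop ∂(gameLaw P σ τ x₀)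

end RedBlack

end

noncomputable section

namespace RedBlack

open Preorder

variable {M : ℕ}

/-! Against timid play a bold player either gains one unit or is ruined, so from `x` bold play wins
with probability `Q x = ∏ φ k` over `x ≤ k < M`. The inequality on `φ` makes `Q` superharmonic for
every legal bet (`stage_boldValue_le`), so optional stopping bounds the probability of success under
any strategy by `Q x₀`. For the expected fortune, paths that never end must also be controlled. The
process is therefore stopped on `sureWin φ`, where `Q = 1`. Off this set `φ` is bounded away from
`1`, and a contracting potential with Borel–Cantelli forces ruin (`ae_hits_sureWin_or_ruined`).
Hence the expected fortune is at most `M * Q x₀`. Bold play attains both bounds, since it is decided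
within `M` stages (`boldValue_le_measure`). -/

/-! ### Super- and submartingale estimates for the law of the game -/

theorem lintegral_gameLaw_succ (P : State M → State M → unitInterval) (σ τ : Strategy M)
    (x₀ : State M) (n : ℕ) {G : History M n × State M → ℝ≥0∞} :
    ∫⁻ X, G (frestrictLe n X, X (n + 1)) ∂gameLaw P σ τ x₀ =
      ∫⁻ X, ∫⁻ y, G (frestrictLe n X, y) ∂nextLaw P σ τ n (frestrictLe n X)
        ∂gameLaw P σ τ x₀ := by
  have hG : Measurable G := measurable_of_countable _
  have hp : Measurable fun X : ℕ → State M =>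
      ((frestrictLe n X, X (n + 1)) : History M n × State M) := by fun_prop
  have h1 := Kernel.partialTraj_compProd_eq_map_traj (X := fun _ => State M) (κ := stepKernel P σ τ)
    (zero_le (a := n)) (x₀ := fun _ => x₀)
  have h2 := Kernel.traj_map_frestrictLe_apply (X := fun _ => State M)
    (κ := stepKernel P σ τ) 0 n (fun _ => x₀)
  rw [← h2] at h1
  have h3 := congrArg (fun μ => ∫⁻ z, G z ∂μ) h1
  rw [Measure.lintegral_compProd hG, lintegral_map (measurable_of_countable _) (by fun_prop),
    lintegral_map hG hp] at h3
  exact h3.symm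

theorem gameLaw_zero (P : State M → State M → unitInterval) (σ τ : Strategy M) (x₀ : State M)
    (f : State M → ℝ≥0∞) : ∫⁻ X, f (X 0) ∂gameLaw P σ τ x₀ = f x₀ := by
  have h2 := Kernel.traj_map_frestrictLe_apply (X := fun _ => State M)
    (κ := stepKernel P σ τ) 0 0 (fun _ => x₀)
  have h3 := congrArg (fun μ => ∫⁻ z : History M 0, f z.current ∂μ) h2
  rw [lintegral_map (measurable_of_countable _) (by fun_prop), Kernel.partialTraj_self,
    Kernel.id_apply, lintegral_dirac] at h3
  exact h3

instance (P : State M → State M → unitInterval) (σ τ : Strategy M) (x₀ : State M) :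
    IsProbabilityMeasure (gameLaw P σ τ x₀) :=
  inferInstanceAs (IsProbabilityMeasure (Kernel.traj (X := fun _ => State M)
    (stepKernel P σ τ) 0 (fun _ => x₀)))

theorem measurableSet_avoids (A : Set (State M)) (n : ℕ) :
    MeasurableSet {X : ℕ → State M | ∀ i ≤ n, X i ∉ A} := by
  have : MeasurableSet (⋂ i ≤ n, (fun X : ℕ → State M => X i) ⁻¹' Aᶜ) :=
    .iInter fun i => .iInter fun _ => measurable_pi_apply i (Set.toFinite _).measurableSet
  convert this using 1
  ext X; simp

/-- If `u` shrinks by the factor `r` in expectation as long as the fortune stays outside `A`, then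
so does the process that is frozen at the value `v` when `A` is entered. -/
theorem lintegral_stopped_le (P : State M → State M → unitInterval) (σ τ : Strategy M)
    (x₀ : State M) (A : Set (State M)) [DecidablePred (· ∈ A)] (u : State M → ℝ≥0∞)
    (v r : ℝ≥0∞) (hv : ∀ x ∈ A, v ≤ u x) (hr : v ≤ r * v)
    (hstep : ∀ n (h : History M n), h.current ∉ A →
      ∫⁻ y, u y ∂nextLaw P σ τ n h ≤ r * u h.current) (n : ℕ) :
    ∫⁻ X, (if ∀ i ≤ n, X i ∉ A then u (X n) else v) ∂gameLaw P σ τ x₀ ≤ r ^ n * u x₀ := by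
  classical
  induction n with
  | zero =>
    rw [pow_zero, one_mul, ← gameLaw_zero P σ τ x₀ u]
    refine lintegral_mono fun X => ?_
    dsimp only
    split_ifs with h
    · exact le_rfl
    · simp only [Nat.le_zero, forall_eq, not_not] at h
      exact hv _ h
  | succ n ih =>
    let G : History M n × State M → ℝ≥0∞ := fun z => if ∀ i, z.1 i ∉ A then u z.2 else v
    have hN (X : ℕ → State M) : (∀ i, (frestrictLe n X : History M n) i ∉ A) ↔
        ∀ i ≤ n, X i ∉ A := by simp [frestrictLe]
    -- `G` freezes one stage late: if `A` is first entered at stage `n + 1`, it keeps `u (X (n + 1))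
    -- ≥ v`.
    calc _ ≤ ∫⁻ X, G (frestrictLe n X, X (n + 1)) ∂gameLaw P σ τ x₀ := by
          refine lintegral_mono fun X => ?_
          simp only [G, hN]
          split_ifs with h1 h2 h2
          · exact le_rfl
          · exact absurd (fun i hi => h1 i (hi.trans n.le_succ)) h2
          · refine hv _ (by_contra fun h3 => h1 fun i hi => ?_)
            rcases Nat.le_succ_iff.1 hi with hi | rfl
            exacts [h2 i hi, h3]
          · exact le_rfl
      _ = _ := lintegral_gameLaw_succ P σ τ x₀ n
      _ ≤ ∫⁻ X, r * (if ∀ i ≤ n, X i ∉ A then u (X n) else v) ∂gameLaw P σ τ x₀ := by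
          refine lintegral_mono fun X => ?_
          simp only [G, hN]
          split_ifs with h
          · exact hstep n _ (h n le_rfl)
          · simpa using hr
      _ = r * ∫⁻ X, (if ∀ i ≤ n, X i ∉ A then u (X n) else v) ∂gameLaw P σ τ x₀ := by
          refine lintegral_const_mul r (Measurable.ite ?_ ?_ measurable_const)
          · exact measurableSet_avoids A n
          · exact (measurable_of_countable u).comp (measurable_pi_apply n)
      _ ≤ r ^ (n + 1) * u x₀ := by
          rw [pow_succ', mul_assoc]; gcongr

/-- Here `u` may depend on the stage, as the truncated bold value below does. -/
theorem le_lintegral_of_le_step (P : State M → State M → unitInterval) (σ τ : Strategy M)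
    (x₀ : State M) (u : ℕ → State M → ℝ≥0∞)
    (hstep : ∀ n (h : History M n), u n h.current ≤ ∫⁻ y, u (n + 1) y ∂nextLaw P σ τ n h)
    (n : ℕ) : u 0 x₀ ≤ ∫⁻ X, u n (X n) ∂gameLaw P σ τ x₀ := by
  induction n with
  | zero => exact (gameLaw_zero P σ τ x₀ (u 0)).ge
  | succ n ih =>
    refine ih.trans ?_
    rw [lintegral_gameLaw_succ P σ τ x₀ n (G := fun z => u (n + 1) z.2)]
    exact lintegral_mono fun X => hstep n _

/-! ### A single stage against timid play -/

/-- The expectation of `f` after a stage with fortune `x` and bets `a`, `b`. -/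
def stageValue (P : State M → State M → unitInterval) (x a b : State M) (f : State M → ℝ≥0∞) :
    ℝ≥0∞ :=
  ENNReal.ofReal (P a b) * f (up x b) + ENNReal.ofReal (1 - P a b) * f (down x a)

theorem lintegral_move (P : State M → State M → unitInterval) (x a b : State M)
    (f : State M → ℝ≥0∞) : ∫⁻ y, f y ∂move P x a b = stageValue P x a b f := by
  have h1 (p : unitInterval) : ENNReal.ofReal (p : ℝ) = (unitInterval.toNNReal p : ℝ≥0∞) := by
    rw [ENNReal.ofReal, ENNReal.coe_inj]
    exact Real.toNNReal_of_nonneg p.2.1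
  rw [move, bernoulliMeasure_def, lintegral_add_measure, stageValue, h1,
    ← unitInterval.coe_symm_eq, h1, lintegral_smul_measure, lintegral_smul_measure,
    lintegral_dirac, lintegral_dirac]
  rfl

theorem lintegral_nextLaw (P : State M → State M → unitInterval) (σ τ : Strategy M) (n : ℕ)
    (h : History M n) (f : State M → ℝ≥0∞) :
    ∫⁻ y, f y ∂nextLaw P σ τ n h =
      ∑ a, ∑ b, σ.bet n h a * τ.bet n h.opponent b * stageValue P h.current a b f := by
  rw [nextLaw, lintegral_finsetSum_measure]
  refine Finset.sum_congr rfl fun a _ => ?_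
  rw [lintegral_finsetSum_measure]
  refine Finset.sum_congr rfl fun b _ => ?_
  rw [lintegral_smul_measure, lintegral_move, smul_eq_mul]

/-- The timid bet of player II when player I's fortune is `x`. -/
def timidReply (x : State M) : State M := if x = Fin.last M then 0 else 1

theorem lintegral_nextLaw_timid (P : State M → State M → unitInterval) (σ : Strategy M) (n : ℕ)
    (h : History M n) (f : State M → ℝ≥0∞) :
    ∫⁻ y, f y ∂nextLaw P σ (timid M) n h =
      ∑ a, σ.bet n h a * stageValue P h.current a (timidReply h.current) f := by
  rw [lintegral_nextLaw]
  refine Finset.sum_congr rfl fun a _ => ?_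
  have h0 : (h.opponent.current = 0) = (h.current = Fin.last M) := by
    change (h.current.rev = 0) = _
    rw [← Fin.rev_last, Fin.rev_inj]
  have h1 : (timid M).bet n h.opponent = PMF.pure (timidReply h.current) := by
    simp only [timid, h0, timidReply]
  rw [h1, Finset.sum_eq_single (timidReply h.current)]
  · simp
  · intro b _ hb
    rw [PMF.pure_apply, if_neg hb]; simp
  · simp

theorem lintegral_nextLaw_timid_le (P : State M → State M → unitInterval) (σ : Strategy M) (n : ℕ)
    (h : History M n) (f : State M → ℝ≥0∞) (C : ℝ≥0∞)
    (hC : ∀ a, a ≤ h.current → (0 < h.current → 0 < a) →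
      stageValue P h.current a (timidReply h.current) f ≤ C) :
    ∫⁻ y, f y ∂nextLaw P σ (timid M) n h ≤ C := by
  rw [lintegral_nextLaw_timid]
  calc _ ≤ ∑ a, σ.bet n h a * C := Finset.sum_le_sum fun a _ => by
        by_cases ha : σ.bet n h a = 0
        · simp [ha]
        · have := σ.legal n h a ((PMF.mem_support_iff _ _).2 ha)
          gcongr
          exact hC a this.1 this.2
    _ = C := by
        rw [← Finset.sum_mul, ← tsum_fintype (L := .unconditional _), PMF.tsum_coe, one_mul]

theorem lintegral_nextLaw_bold_timid (P : State M → State M → unitInterval) (n : ℕ)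
    (h : History M n) (f : State M → ℝ≥0∞) :
    ∫⁻ y, f y ∂nextLaw P (bold M) (timid M) n h =
      stageValue P h.current h.current (timidReply h.current) f := by
  rw [lintegral_nextLaw_timid, Finset.sum_eq_single h.current]
  · simp [bold]
  · intro b _ hb
    simp only [bold]
    rw [PMF.pure_apply, if_neg hb, zero_mul]
  · simp

/-! ### The value of bold play and a contracting potential -/

/-- The probability that bold play wins against timid play from the fortune `x`, where `φ k` is
the probability of winning a stage with the bet `k`. -/
def boldValue (φ : State M → ℝ) (x : ℕ) : ℝ := ∏ k ∈ Finset.Ico x M, φ (Fin.ofNat (M + 1) k)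

section

variable {φ : State M → ℝ} (h0 : ∀ x, 0 ≤ φ x) (h1 : ∀ x, φ x ≤ 1)

include h0 in
theorem boldValue_nonneg (x : ℕ) : 0 ≤ boldValue φ x := Finset.prod_nonneg fun _ _ => h0 _

theorem boldValue_top : boldValue φ M = 1 := by simp [boldValue]

theorem ofNat_val (x : State M) : Fin.ofNat (M + 1) (x : ℕ) = x := by simp

theorem boldValue_eq_mul (x : State M) (hx : (x : ℕ) < M) :
    boldValue φ x = φ x * boldValue φ (x + 1) := by
  rw [boldValue, Finset.prod_eq_prod_Ico_succ_bot hx, ofNat_val]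
  rfl

include h0 h1 in
theorem boldValue_mono : Monotone (boldValue φ) := by
  refine monotone_nat_of_le_succ fun x => ?_
  rcases lt_or_ge x M with hx | hx
  · rw [boldValue_eq_mul ⟨x, hx.trans M.lt_succ_self⟩ hx]
    exact mul_le_of_le_one_left (boldValue_nonneg h0 _) (h1 _)
  · simp [boldValue, hx, hx.trans x.le_succ]

theorem boldValue_eq_one (h1 : ∀ x, φ x ≤ 1) (hmono : Monotone φ) {x : State M} (hx : φ x = 1) :
    boldValue φ x = 1 := by
  refine Finset.prod_eq_one fun k hk => (h1 _).antisymm (hx.symm.le.trans (hmono ?_))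
  rw [Finset.mem_Ico] at hk
  rw [Fin.le_def, Fin.val_ofNat, Nat.mod_eq_of_lt (by omega)]
  exact hk.1

/-- Bold play is conserving: no bet improves on it when bold play is used afterwards. -/
theorem stage_boldValue_le (h0 : ∀ x, 0 ≤ φ x) (h1 : ∀ x, φ x ≤ 1) (hφ0 : φ 0 = 0)
    (hφ_ineq : ∀ x y : State M, y ≤ x → φ y - φ x ≤ φ (x - y) * (φ y - 1))
    {x a : State M} (hx : (x : ℕ) < M) (ha : a ≤ x) (ha0 : 0 < x → 0 < a) :
    φ a * boldValue φ (x + 1) + (1 - φ a) * boldValue φ (x - a) ≤ boldValue φ x := by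
  rcases (Fin.zero_le x).eq_or_lt with rfl | hx0
  · obtain rfl : a = 0 := le_antisymm ha (Fin.zero_le _)
    simp [hφ0]
  have hsub : ((x - a : State M) : ℕ) = x - a := Fin.sub_val_of_le ha
  have ha1 : 0 < (a : ℕ) := ha0 hx0
  -- After a loss, bold play must win its next stage, and it then stands no better than at `x + 1`.
  have hle : boldValue φ (x - a) ≤ φ (x - a) * boldValue φ (x + 1) := by
    rw [← hsub, boldValue_eq_mul (x - a) (by omega), hsub]
    exact mul_le_mul_of_nonneg_left (boldValue_mono h0 h1 (by omega)) (h0 _)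
  rw [boldValue_eq_mul x hx]
  calc _ ≤ φ a * boldValue φ (x + 1) + (1 - φ a) * (φ (x - a) * boldValue φ (x + 1)) := by
        gcongr
        linarith [h1 a]
    _ = (φ a + (1 - φ a) * φ (x - a)) * boldValue φ (x + 1) := by ring
    _ ≤ _ := mul_le_mul_of_nonneg_right (by linarith [hφ_ineq x a ha]) (boldValue_nonneg h0 _)

/-- While every winning probability is at most `q < 1`, the potential `1 - (1 - q) ^ k` decreases
by a fixed factor in expectation. -/
theorem stage_potential_le (hφ0 : φ 0 = 0) (hmono : Monotone φ) {q : ℝ}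
    (hq0 : 0 < q) (hq1 : q < 1) {x a : State M} (hx : (x : ℕ) < M) (hxq : φ x ≤ q) (ha : a ≤ x)
    (ha0 : 0 < x → 0 < a) :
    φ a * (1 - (1 - q) ^ ((x : ℕ) + 1)) + (1 - φ a) * (1 - (1 - q) ^ ((x : ℕ) - a)) ≤
      (1 - q * (1 - q) ^ (M + 1)) * (1 - (1 - q) ^ (x : ℕ)) := by
  have hε0 : 0 ≤ 1 - q := by linarith
  have hε1 : 1 - q ≤ 1 := by linarith
  rcases (Fin.zero_le x).eq_or_lt with rfl | hx0
  · obtain rfl : a = 0 := le_antisymm ha (Fin.zero_le _)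
    simp [hφ0]
  have ha1 : 0 < (a : ℕ) := ha0 hx0
  obtain ⟨k, hk⟩ : ∃ k, (x : ℕ) = k + 1 := Nat.exists_eq_succ_of_ne_zero (by
    have : 0 < (x : ℕ) := hx0
    omega)
  have haq : φ a ≤ q := (hmono ha).trans hxq
  have e1 : (1 - q) ^ k ≤ (1 - q) ^ ((x : ℕ) - a) := pow_le_pow_of_le_one hε0 hε1 (by omega)
  have e2 : (1 - q) ^ (M + 1) ≤ (1 - q) ^ (k + 2) := pow_le_pow_of_le_one hε0 hε1 (by omega)
  have e3 : (1 - q) ^ (k + 2) ≤ (1 - q) ^ k := pow_le_pow_of_le_one hε0 hε1 (by omega)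
  have e4 : 0 ≤ (1 - q) ^ (M + 1) := by positivity
  have e5 : 0 ≤ (1 - q) ^ (k + 1) := by positivity
  have e6 : (1 - q) ^ (k + 1) = (1 - q) * (1 - q) ^ k := pow_succ' _ _
  rw [hk]
  -- A positive bet loses at least one unit, so the unit bet is the worst case.
  calc _ ≤ φ a * (1 - (1 - q) ^ (k + 2)) + (1 - φ a) * (1 - (1 - q) ^ k) := by
        rw [hk] at e1
        have : 0 ≤ 1 - φ a := by linarith
        gcongr
    _ = (1 - (1 - q) ^ k) + φ a * ((1 - q) ^ k - (1 - q) ^ (k + 2)) := by ring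
    _ ≤ (1 - (1 - q) ^ k) + q * ((1 - q) ^ k - (1 - q) ^ (k + 2)) := by gcongr
    _ = 1 - (1 - q) ^ (k + 1) - q * (1 - q) ^ (k + 2) := by rw [e6]; ring
    _ ≤ 1 - (1 - q) ^ (k + 1) - q * (1 - q) ^ (M + 1) := by gcongr
    _ ≤ _ := by nlinarith [mul_nonneg (mul_nonneg hq0.le e4) e5]

end

/-! ### Upper bounds for an arbitrary strategy -/

theorem stageValue_timidReply {P : State M → State M → unitInterval} {φ : State M → ℝ}
    (hφ : ∀ x, φ x = P x 1) {x a : State M} (hx : (x : ℕ) < M) {g : ℕ → ℝ} (hg : ∀ k, 0 ≤ g k) :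
    stageValue P x a (timidReply x) (fun y => ENNReal.ofReal (g y)) =
      ENNReal.ofReal (φ a * g (x + 1) + (1 - φ a) * g (x - a)) := by
  have hb : timidReply x = 1 := if_neg fun h => by simp [h] at hx
  have h1 : ((1 : State M) : ℕ) = 1 := by
    rw [Fin.val_one']; exact Nat.mod_eq_of_lt (by omega)
  have hup : (up x 1 : ℕ) = x + 1 := by
    simp only [up, h1]; omega
  have hp := (P a 1).2
  rw [stageValue, hb, hup, ← ENNReal.ofReal_mul hp.1, ← ENNReal.ofReal_mul (by linarith [hp.2]),
    ← ENNReal.ofReal_add (mul_nonneg hp.1 (hg _)) (mul_nonneg (by linarith [hp.2]) (hg _)), hφ]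
  rfl

theorem exists_uniform_lt_one (φ : State M → ℝ) :
    ∃ q, 0 < q ∧ q < 1 ∧ ∀ x, φ x < 1 → φ x ≤ q := by
  obtain ⟨z, -, hz⟩ := Finset.exists_max_image Finset.univ
    -- The value `1 / 2` keeps `q` strictly between `0` and `1` in all cases.
    (fun x => if φ x < 1 then max (φ x) (1 / 2) else 1 / 2) Finset.univ_nonempty
  refine ⟨_, ?_, ?_, fun x hx => le_trans ?_ (hz x (Finset.mem_univ x))⟩
  · split_ifs <;> simp
  · split_ifs with h
    · exact max_lt h (by norm_num)
    · norm_num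
  · simp [hx]

section

variable {P : State M → State M → unitInterval} {φ : State M → ℝ}

/-- The fortunes from which bold play surely wins. -/
def sureWin (φ : State M → ℝ) : Set (State M) := {x | x = Fin.last M ∨ φ x = 1}

theorem lt_of_notMem_sureWin {x : State M} (hx : x ∉ sureWin φ) : (x : ℕ) < M :=
  Fin.val_lt_last fun h => hx (.inl h)

/-- The bold value frozen at `1` on `sureWin φ` dominates the indicator of having entered that set.
-/
theorem measure_hits_sureWin_le (hφ : ∀ x, φ x = P x 1) (hφ0 : φ 0 = 0) (hmono : Monotone φ)
    (hφ_ineq : ∀ x y : State M, y ≤ x → φ y - φ x ≤ φ (x - y) * (φ y - 1))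
    (σ : Strategy M) (x₀ : State M) :
    gameLaw P σ (timid M) x₀ {X | ∃ n, X n ∈ sureWin φ} ≤ ENNReal.ofReal (boldValue φ x₀) := by
  classical
  have h0 (x) : 0 ≤ φ x := hφ x ▸ (P x 1).2.1
  have h1 (x) : φ x ≤ 1 := hφ x ▸ (P x 1).2.2
  have key (n : ℕ) := lintegral_stopped_le P σ (timid M) x₀ (sureWin φ)
    (fun x => ENNReal.ofReal (boldValue φ x)) 1 1 (by
      rintro x (rfl | hx)
      · simp [boldValue_top]
      · simp [boldValue_eq_one h1 hmono hx]) (by simp) (fun n h hh => by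
      rw [one_mul]
      refine lintegral_nextLaw_timid_le _ _ _ _ _ _ fun a ha ha0 => ?_
      rw [stageValue_timidReply hφ (lt_of_notMem_sureWin hh) (boldValue_nonneg h0)]
      exact ENNReal.ofReal_le_ofReal
        (stage_boldValue_le h0 h1 hφ0 hφ_ineq (lt_of_notMem_sureWin hh) ha ha0)) n
  have hU : {X : ℕ → State M | ∃ n, X n ∈ sureWin φ} =
      ⋃ n, {X : ℕ → State M | ∀ i ≤ n, X i ∉ sureWin φ}ᶜ := by
    ext X
    simp only [Set.mem_ofPred_eq, Set.mem_iUnion, Set.mem_compl_iff, not_forall, not_not]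
    exact ⟨fun ⟨n, hn⟩ => ⟨n, n, le_rfl, hn⟩, fun ⟨_, n, _, hn⟩ => ⟨n, hn⟩⟩
  have hmon : Monotone fun n => {X : ℕ → State M | ∀ i ≤ n, X i ∉ sureWin φ}ᶜ :=
    fun m n hmn => Set.compl_subset_compl.2 fun X h i hi => h i (hi.trans hmn)
  rw [hU, hmon.measure_iUnion]
  refine iSup_le fun n => ?_
  rw [← lintegral_indicator_one (measurableSet_avoids _ n).compl]
  refine (lintegral_mono fun X => ?_).trans ((key n).trans (by simp))
  by_cases h : ∀ i ≤ n, X i ∉ sureWin φ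
  · rw [Set.indicator_of_notMem (by simpa using h)]
    exact zero_le
  · rw [if_neg h]
    exact Set.indicator_le_self' (fun _ _ => zero_le) X

theorem ae_hits_sureWin_or_ruined (hφ : ∀ x, φ x = P x 1) (hφ0 : φ 0 = 0) (hmono : Monotone φ)
    (σ : Strategy M) (x₀ : State M) :
    ∀ᵐ X ∂gameLaw P σ (timid M) x₀, (∃ n, X n ∈ sureWin φ) ∨ ∀ᶠ n in atTop, X n = 0 := by
  classical
  have h0 (x) : 0 ≤ φ x := hφ x ▸ (P x 1).2.1
  have h1 (x) : φ x ≤ 1 := hφ x ▸ (P x 1).2.2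
  obtain ⟨q, hq0, hq1, hq⟩ := exists_uniform_lt_one φ
  set θ := 1 - q * (1 - q) ^ (M + 1) with hθ
  have hε0 : 0 < 1 - q := by linarith
  have hpow : (1 - q) ^ (M + 1) ≤ 1 := pow_le_one₀ hε0.le (by linarith)
  have hθ0 : 0 ≤ θ := by nlinarith
  have hθ1 : θ < 1 := by
    have : 0 < q * (1 - q) ^ (M + 1) := by positivity
    linarith
  have hg (k : ℕ) : 0 ≤ 1 - (1 - q) ^ k :=
    sub_nonneg.2 (pow_le_one₀ hε0.le (by linarith))
  have key (n : ℕ) := lintegral_stopped_le P σ (timid M) x₀ (sureWin φ)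
    (fun x => ENNReal.ofReal (1 - (1 - q) ^ (x : ℕ))) 0 (ENNReal.ofReal θ)
    (fun _ _ => zero_le) zero_le (fun n h hh => by
      refine lintegral_nextLaw_timid_le _ _ _ _ _ _ fun a ha ha0 => ?_
      have hx := lt_of_notMem_sureWin hh
      rw [stageValue_timidReply (g := fun k => 1 - (1 - q) ^ k) hφ hx hg,
        ← ENNReal.ofReal_mul hθ0]
      exact ENNReal.ofReal_le_ofReal (stage_potential_le hφ0 hmono hq0 hq1 hx
        (hq _ ((h1 _).lt_of_ne fun h => hh (.inr h))) ha ha0)) n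
  let B (n : ℕ) : Set (ℕ → State M) := {X | (∀ i ≤ n, X i ∉ sureWin φ) ∧ X n ≠ 0}
  have hBm (n : ℕ) : MeasurableSet (B n) := (measurableSet_avoids _ n).inter
    (s₂ := (fun X : ℕ → State M => X n) ⁻¹' {x | x ≠ 0})
    (measurable_pi_apply n (Set.toFinite _).measurableSet)
  -- The potential is at least `q` at every positive fortune and at most `1` at the start.
  have hB (n : ℕ) : ENNReal.ofReal q * gameLaw P σ (timid M) x₀ (B n) ≤ ENNReal.ofReal θ ^ n := by
    rw [← lintegral_indicator_const (hBm n)]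
    refine (lintegral_mono fun X => ?_).trans ((key n).trans (mul_le_of_le_one_right' ?_))
    · refine Set.indicator_le (g := fun X : ℕ → State M => if ∀ i ≤ n, X i ∉ sureWin φ then
        ENNReal.ofReal (1 - (1 - q) ^ (X n : ℕ)) else 0) (fun X hX => ?_) X
      rw [if_pos hX.1]
      refine ENNReal.ofReal_le_ofReal ?_
      have : (1 - q) ^ (X n : ℕ) ≤ (1 - q) ^ 1 := pow_le_pow_of_le_one hε0.le (by linarith)
        (Nat.one_le_iff_ne_zero.2 fun h => hX.2 (Fin.ext h))
      linarith
    · rw [ENNReal.ofReal_le_one]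
      linarith [pow_nonneg hε0.le (x₀ : ℕ)]
  have hsum : ∑' n, gameLaw P σ (timid M) x₀ (B n) ≠ ∞ := by
    have hs : ENNReal.ofReal q * ∑' n, gameLaw P σ (timid M) x₀ (B n) ≤
        (1 - ENNReal.ofReal θ)⁻¹ := by
      rw [← ENNReal.tsum_mul_left, ← ENNReal.tsum_geometric]
      exact ENNReal.tsum_le_tsum hB
    intro h
    rw [h, ENNReal.mul_top (by simpa using hq0), top_le_iff, ENNReal.inv_eq_top,
      tsub_eq_zero_iff_le] at hs
    exact absurd (ENNReal.one_le_ofReal.1 hs) (not_le.2 hθ1)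
  filter_upwards [ae_eventually_notMem hsum] with X hX
  refine or_iff_not_imp_left.2 fun hA => hX.mono fun n hn => ?_
  by_contra h
  exact hn ⟨fun i _ hi => hA ⟨i, hi⟩, h⟩

theorem winProb_timid_le (hφ : ∀ x, φ x = P x 1) (hφ0 : φ 0 = 0) (hmono : Monotone φ)
    (hφ_ineq : ∀ x y : State M, y ≤ x → φ y - φ x ≤ φ (x - y) * (φ y - 1))
    (σ : Strategy M) (x₀ : State M) :
    winProb P σ (timid M) x₀ ≤ ENNReal.ofReal (boldValue φ x₀) :=
  (measure_mono (Set.ofPred_subset_ofPred.2 fun _ ⟨n, hn⟩ => ⟨n, .inl hn⟩)).trans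
    (measure_hits_sureWin_le hφ hφ0 hmono hφ_ineq σ x₀)

/-- Almost every path avoiding `sureWin φ` has upper limit `0`; on the others `M` is a trivial
bound. -/
theorem expectedFortune_timid_le (hφ : ∀ x, φ x = P x 1) (hφ0 : φ 0 = 0) (hmono : Monotone φ)
    (hφ_ineq : ∀ x y : State M, y ≤ x → φ y - φ x ≤ φ (x - y) * (φ y - 1))
    (σ : Strategy M) (x₀ : State M) :
    expectedFortune P σ (timid M) x₀ ≤ M * ENNReal.ofReal (boldValue φ x₀) := by
  have hm : MeasurableSet {X : ℕ → State M | ∃ n, X n ∈ sureWin φ} := by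
    have : MeasurableSet (⋃ n, (fun X : ℕ → State M => X n) ⁻¹' sureWin φ) :=
      .iUnion fun n => measurable_pi_apply n (Set.toFinite _).measurableSet
    convert this using 1
    ext X; simp
  calc _ ≤ ∫⁻ X, {X : ℕ → State M | ∃ n, X n ∈ sureWin φ}.indicator (fun _ => (M : ℝ≥0∞)) X
        ∂gameLaw P σ (timid M) x₀ := by
        refine lintegral_mono_ae ?_
        filter_upwards [ae_hits_sureWin_or_ruined hφ hφ0 hmono σ x₀] with X hX
        by_cases hA : ∃ n, X n ∈ sureWin φ
        · rw [Set.indicator_of_mem (s := {X : ℕ → State M | ∃ n, X n ∈ sureWin φ}) hA]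
          refine limsup_le_of_le (by isBoundedDefault) (.of_forall fun n => ?_)
          exact_mod_cast Nat.lt_succ_iff.1 (X n).isLt
        · have hz : ∀ᶠ n in atTop, ((X n : ℕ) : ℝ≥0∞) = 0 :=
            (hX.resolve_left hA).mono fun n hn => by simp [hn]
          rw [limsup_congr hz]
          simp
    _ ≤ _ := by
        rw [lintegral_indicator_const hm]
        gcongr
        exact measure_hits_sureWin_le hφ hφ0 hmono hφ_ineq σ x₀

/-! ### Attainment of the bounds by bold play -/

/-- Under bold play against timid play, the fortune at a stage `n ≥ M` is the goal with probability
at least `boldValue φ x₀`. -/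
theorem boldValue_le_measure (hP_right : ∀ a : State M, a ≠ 0 → P a 0 = 1) (hM : M ≠ 0)
    (hφ : ∀ x, φ x = P x 1) (hφ0 : φ 0 = 0) (x₀ : State M) {n : ℕ} (hn : M ≤ n) :
    ENNReal.ofReal (boldValue φ x₀) ≤
      gameLaw P (bold M) (timid M) x₀ {X | X n = Fin.last M} := by
  classical
  have h0 (x) : 0 ≤ φ x := hφ x ▸ (P x 1).2.1
  -- After `n` bold stages an undecided fortune is at least `n + 1`. Discarding smaller fortunes
  -- keeps the submartingale inequality and leaves only the goal once `n ≥ M`.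
  let g (n k : ℕ) : ℝ := if k = M ∨ n + 1 ≤ k then boldValue φ k else 0
  have hg (n k) : 0 ≤ g n k := by
    simp only [g]; split_ifs
    exacts [boldValue_nonneg h0 k, le_rfl]
  have hgM (n) : g n M = 1 := by simp [g, boldValue_top]
  have key := le_lintegral_of_le_step P (bold M) (timid M) x₀
    (fun n y => ENNReal.ofReal (g n y)) (fun n h => by
      rw [lintegral_nextLaw_bold_timid]
      by_cases hx : h.current = Fin.last M
      · have hlast : Fin.last M ≠ 0 := fun h => hM (congrArg Fin.val h)
        simp [hx, stageValue, timidReply, hP_right _ hlast, up, hgM]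
      · have hlt : (h.current : ℕ) < M := Fin.val_lt_last hx
        rw [stageValue_timidReply hφ hlt (hg _)]
        refine ENNReal.ofReal_le_ofReal ?_
        have h1 : 0 ≤ 1 - φ h.current := by
          rw [hφ]; linarith [(P h.current 1).2.2]
        have h2 := mul_nonneg h1 (hg (n + 1) (h.current - h.current))
        refine le_trans ?_ (le_add_of_nonneg_right h2)
        by_cases hc : n + 1 ≤ (h.current : ℕ)
        · simp only [g, hc, or_true, if_true, boldValue_eq_mul _ hlt]
          rw [if_pos (.inr (by omega))]
        · simp only [g, hc, hlt.ne, or_self, if_false]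
          exact mul_nonneg (h0 _) (hg _ _)) n
  have hz : g 0 x₀ = boldValue φ x₀ := by
    by_cases hx : x₀ = 0
    · have : boldValue φ (0 : State M) = 0 := by
        rw [boldValue_eq_mul _ (Nat.pos_of_ne_zero hM), hφ0, zero_mul]
      simp only [g, hx, this, ite_self]
    · exact if_pos (.inr (Nat.one_le_iff_ne_zero.2 fun h => hx (Fin.ext h)))
  rw [hz] at key
  refine key.trans ?_
  have hm : MeasurableSet {X : ℕ → State M | X n = Fin.last M} :=
    measurable_pi_apply n (measurableSet_singleton _)
  rw [← lintegral_indicator_one hm]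
  refine lintegral_mono fun X => ?_
  by_cases hX : X n = Fin.last M
  · rw [Set.indicator_of_mem (s := {X : ℕ → State M | X n = Fin.last M}) hX]
    simp [hX, hgM]
  · have hlt : (X n : ℕ) < M := Fin.val_lt_last hX
    have : g n (X n) = 0 := if_neg (by omega)
    simp [this]

theorem boldValue_le_winProb (hP_right : ∀ a : State M, a ≠ 0 → P a 0 = 1) (hM : M ≠ 0)
    (hφ : ∀ x, φ x = P x 1) (hφ0 : φ 0 = 0) (x₀ : State M) :
    ENNReal.ofReal (boldValue φ x₀) ≤ winProb P (bold M) (timid M) x₀ :=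
  (boldValue_le_measure hP_right hM hφ hφ0 x₀ le_rfl).trans
    (measure_mono (Set.ofPred_subset_ofPred.2 fun _ h => ⟨M, h⟩))

theorem boldValue_le_expectedFortune (hP_right : ∀ a : State M, a ≠ 0 → P a 0 = 1) (hM : M ≠ 0)
    (hφ : ∀ x, φ x = P x 1) (hφ0 : φ 0 = 0) (x₀ : State M) :
    M * ENNReal.ofReal (boldValue φ x₀) ≤ expectedFortune P (bold M) (timid M) x₀ := by
  -- Reverse Fatou, with the fortunes dominated by `M`.
  refine le_trans ?_ (limsup_lintegral_le (fun _ => (M : ℝ≥0∞))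
    (fun n => (measurable_of_countable fun x : State M => ((x : ℕ) : ℝ≥0∞)).comp
      (measurable_pi_apply n))
    (fun n => .of_forall fun X => Nat.cast_le.2 (Nat.lt_succ_iff.1 (X n).isLt)) (by simp))
  refine le_limsup_of_frequently_le (Eventually.frequently ?_) (by isBoundedDefault)
  filter_upwards [eventually_ge_atTop M] with n hn
  have hm : MeasurableSet {X : ℕ → State M | X n = Fin.last M} :=
    measurable_pi_apply n (measurableSet_singleton _)
  calc _ ≤ M * gameLaw P (bold M) (timid M) x₀ {X | X n = Fin.last M} := by
        gcongr
        exact boldValue_le_measure hP_right hM hφ hφ0 x₀ hn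
    _ = ∫⁻ X, {X : ℕ → State M | X n = Fin.last M}.indicator (fun _ => (M : ℝ≥0∞)) X
        ∂gameLaw P (bold M) (timid M) x₀ := (lintegral_indicator_const hm _).symm
    _ ≤ _ := lintegral_mono fun X => by
        refine Set.indicator_le (g := fun X : ℕ → State M => ((X n : ℕ) : ℝ≥0∞))
          (fun X hX => ?_) X
        rw [show X n = Fin.last M from hX]; simp

end

end RedBlack

end

theorem mainTheorem2 (M : ℕ) (hM : 2 ≤ M)
    (P : RedBlack.State M → RedBlack.State M → unitInterval)
    (hP_right : ∀ a : RedBlack.State M, a ≠ 0 → P a 0 = 1)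
    (hP_left : ∀ b : RedBlack.State M, b ≠ 0 → P 0 b = 0)
    (φ : RedBlack.State M → ℝ) (hφ : ∀ x, φ x = (P x 1 : ℝ))
    (hφ_mono : Monotone φ)
    (hφ_ineq : ∀ x y : RedBlack.State M, y ≤ x → φ y - φ x ≤ φ (x - y) * (φ y - 1)) :
    ∀ (x₀ : RedBlack.State M) (σ : RedBlack.Strategy M),
      RedBlack.winProb P σ (RedBlack.timid M) x₀ ≤
          RedBlack.winProb P (RedBlack.bold M) (RedBlack.timid M) x₀ ∧
        RedBlack.expectedFortune P σ (RedBlack.timid M) x₀ ≤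
          RedBlack.expectedFortune P (RedBlack.bold M) (RedBlack.timid M) x₀ := by
  have h10 : (1 : RedBlack.State M) ≠ 0 := fun h => by
    have h' := congrArg Fin.val h
    rw [Fin.val_one', Nat.mod_eq_of_lt (by omega)] at h'
    simp at h'
  have hφ0 : φ 0 = 0 := by rw [hφ, hP_left 1 h10]; rfl
  have hM0 : M ≠ 0 := by omega
  exact fun x₀ σ =>
    ⟨(RedBlack.winProb_timid_le hφ hφ0 hφ_mono hφ_ineq σ x₀).trans
        (RedBlack.boldValue_le_winProb hP_right hM0 hφ hφ0 x₀),
      (RedBlack.expectedFortune_timid_le hφ hφ0 hφ_mono hφ_ineq σ x₀).trans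
        (RedBlack.boldValue_le_expectedFortune hP_right hM0 hφ hφ0 x₀)⟩
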